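/- Let $k\ge 1$ be an integer, let $q>1$ and $p\ge 1$ be real numbers, and let $Y=Y(k,q)$ be the regular ultrametric space $\{1,\dots,k\}^{\mathbb N}$ of infinite words $\bar x=(x_1,x_2,\dots)$ on $k$ letters, with the distance $d(\bar x,\bar y)=q^{-\min\{i\,:\,x_i\ne y_i\}}$ for $\bar x\neq\bar y$ (and $d(\bar x,\bar x)=0$). Let $\mathscr W_p(Y)$ be the set $\mathscr P(Y)$ of Borel probability measures on $Y$ with the distance $$W_p(\mu,\nu)=\Big(\inf_{\Pi\in\Gamma(\mu,\nu)}\int_{Y\times Y} d(a,b)^p\,\Pi(\mathrm da\,\mathrm db)\Big)^{1/p},$$ where $\Gamma(\mu,\nu)$ is the set of measures on $Y\times Y$ whose projections on the two factors are $\mu$ and $\nu$. For a metric space $Z$ and $s>0$, put $f_s(r)=\exp(-1/r^s)$ for $r>0$ and $f_s(0)=0$, and let $$\Lambda_s(Z)=\lim_{\delta\to0}\ \inf\Big\{\sum_{n} f_s(\operatorname{diam}U_n)\ :\ Z\subset\bigcup_{n} U_n \text{ a countable cover by nonempty sets with } \operatorname{diam}U_n\le\delta\Big\}.$$ The power-exponential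 critical parameter of $Z$ is $\operatorname{crit}_{\mathscr P}Z=\sup\{s>0:\Lambda_s(Z)=+\infty\}\in[0,+\infty]$ (with $\sup\emptyset=0$); that is, it is defined as the Hausdorff dimension is, with $r\mapsto \exp(-1/r^s)$ in the place of $r\mapsto r^s$. Then $$\operatorname{crit}_{\mathscr P}\mathscr W_p(Y)=\log_q k=\dim Y,$$ where $\dim$ denotes the Hausdorff dimension. -/

import Mathlib

open MeasureTheory
open scoped ENNReal NNReal

noncomputable section

/-! ### Transport plans and the Wasserstein space -/

/-- `π` is a transport plan (coupling) between `μ` and `ν`: a measure on `X × X` whose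
projections on the two factors are `μ` and `ν`. -/
def IsTransportPlan {X : Type*} [MeasurableSpace X] (π : Measure (X × X)) (μ ν : Measure X) :
    Prop :=
  π.map Prod.fst = μ ∧ π.map Prod.snd = ν

/-- The `L^p` cost of a transport plan: the integral of `d(a, b) ^ p`. -/
def transportCost {X : Type*} [MeasurableSpace X] [EDist X] (p : ℝ) (π : Measure (X × X)) :
    ℝ≥0∞ :=
  ∫⁻ z, edist z.1 z.2 ^ p ∂π

/-- The `L^p` Wasserstein distance: the `p`-th root of the infimum of the costs of all
transport plans. -/
def wassersteinEDist {X : Type*} [MeasurableSpace X] [EDist X] (p : ℝ) (μ ν : Measure X) :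
    ℝ≥0∞ :=
  (⨅ (π : Measure (X × X)) (_ : IsTransportPlan π μ ν), transportCost p π) ^ (1 / p)

/-- The Wasserstein space `W_p(X)`: its points are the Borel probability measures on `X`. It is
a one-field structure, because it carries the metric `wassersteinEDist p` (see below) and not the
topology that `ProbabilityMeasure X` has in Mathlib. -/
structure WassersteinSpace (p : ℝ) (X : Type*) [MeasurableSpace X] where
  /-- The underlying probability measure. -/
  toProbabilityMeasure : ProbabilityMeasure X

section Metric

set_option linter.unusedSectionVars false

variable {X : Type*} [MetricSpace X] [CompactSpace X] [MeasurableSpace X] [BorelSpace X]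

theorem measurable_edist_rpow (p : ℝ) :
    Measurable fun z : X × X => edist z.1 z.2 ^ p :=
  measurable_edist.pow_const p

theorem wassersteinEDist_eq_iInf {p : ℝ} (hp : 0 < p) (μ ν : Measure X) :
    wassersteinEDist p μ ν =
      ⨅ (π : Measure (X × X)) (_ : IsTransportPlan π μ ν), transportCost p π ^ (1 / p) := by
  have h : 0 < 1 / p := by positivity
  have := fun x => ENNReal.orderIsoRpow_apply (1 / p) h x
  simp only [wassersteinEDist, ← this, OrderIso.map_iInf]

theorem wassersteinEDist_self {p : ℝ} (hp : 0 < p) (μ : Measure X) :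
    wassersteinEDist p μ μ = 0 := by
  have hd : Measurable fun x : X => (x, x) := measurable_id.prodMk measurable_id
  rw [wassersteinEDist_eq_iInf hp, ← nonpos_iff_eq_zero]
  refine (iInf₂_le (μ.map fun x => (x, x)) (And.intro ?_ ?_)).trans ?_
  · rw [Measure.map_map measurable_fst hd]; exact Measure.map_id
  · rw [Measure.map_map measurable_snd hd]; exact Measure.map_id
  · rw [transportCost, lintegral_map (measurable_edist_rpow p) hd]
    simp [hp]

theorem wassersteinEDist_comm_le {p : ℝ} (hp : 0 < p) (μ ν : Measure X) :
    wassersteinEDist p μ ν ≤ wassersteinEDist p ν μ := by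
  rw [wassersteinEDist_eq_iInf hp, wassersteinEDist_eq_iInf hp]
  refine le_iInf₂ fun π hπ => (iInf₂_le (π.map Prod.swap) (And.intro ?_ ?_)).trans_eq ?_
  · rw [Measure.map_map measurable_fst measurable_swap]; exact hπ.2
  · rw [Measure.map_map measurable_snd measurable_swap]; exact hπ.1
  · rw [transportCost, lintegral_map (measurable_edist_rpow p) measurable_swap]
    simp only [transportCost, Prod.fst_swap, Prod.snd_swap, edist_comm]

theorem IsTransportPlan.isProbabilityMeasure {π : Measure (X × X)} {μ ν : Measure X}
    [IsProbabilityMeasure μ] (h : IsTransportPlan π μ ν) : IsProbabilityMeasure π := by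
  refine ⟨?_⟩
  have := measure_univ (μ := μ)
  rwa [← h.1, Measure.map_apply measurable_fst MeasurableSet.univ, Set.preimage_univ] at this

/-- Two transport plans with a common marginal can be glued. -/
theorem exists_glued_plan {π₁ π₂ : Measure (X × X)} {μ ν ρ : Measure X}
    [IsProbabilityMeasure μ] [IsProbabilityMeasure ν]
    (h₁ : IsTransportPlan π₁ μ ν) (h₂ : IsTransportPlan π₂ ν ρ) :
    ∃ γ : Measure ((X × X) × X), γ.map Prod.fst = π₁ ∧
      γ.map (fun w => (w.1.2, w.2)) = π₂ := by
  have := h₁.isProbabilityMeasure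
  have := h₂.isProbabilityMeasure
  cases isEmpty_or_nonempty X with
  | inl hX => exact ⟨0, by simp [Measure.eq_zero_of_isEmpty]⟩
  | inr hX =>
    refine ⟨π₁.compProd (π₂.condKernel.comap Prod.snd measurable_snd), ?_, ?_⟩
    · exact Measure.fst_compProd _ _
    · have hm : Measurable fun w : (X × X) × X => (w.1.2, w.2) := by fun_prop
      have hν : π₂.fst = ν := h₂.1
      refine Eq.trans (Measure.ext fun s hs => ?_) (π₂.disintegrate π₂.condKernel)
      rw [Measure.map_apply hm hs, Measure.compProd_apply (hm hs), Measure.compProd_apply hs, hν,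
        ← h₁.2, lintegral_map (ProbabilityTheory.Kernel.measurable_kernel_prodMk_left hs) measurable_snd]
      rfl

theorem wassersteinEDist_triangle {p : ℝ} (hp : 1 ≤ p) (μ ν ρ : Measure X)
    [IsProbabilityMeasure μ] [IsProbabilityMeasure ν] :
    wassersteinEDist p μ ρ ≤ wassersteinEDist p μ ν + wassersteinEDist p ν ρ := by
  have hp0 : 0 < p := by linarith
  rw [wassersteinEDist_eq_iInf hp0 μ ν, wassersteinEDist_eq_iInf hp0 ν ρ]
  simp only [ENNReal.iInf_add, ENNReal.add_iInf]
  refine le_iInf₂ fun π₂ h₂ => le_iInf₂ fun π₁ h₁ => ?_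
  obtain ⟨γ, hγ₁, hγ₂⟩ := exists_glued_plan h₁ h₂
  have hm : Measurable fun w : (X × X) × X => (w.1.2, w.2) := by fun_prop
  have hm' : Measurable fun w : (X × X) × X => (w.1.1, w.2) := by fun_prop
  have e₁ : transportCost p π₁ = ∫⁻ w, edist w.1.1 w.1.2 ^ p ∂γ := by
    rw [transportCost, ← hγ₁, lintegral_map (measurable_edist_rpow p) measurable_fst]
  have e₂ : transportCost p π₂ = ∫⁻ w, edist w.1.2 w.2 ^ p ∂γ := by
    rw [transportCost, ← hγ₂, lintegral_map (measurable_edist_rpow p) hm]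
  rw [wassersteinEDist_eq_iInf hp0]
  refine (iInf₂_le (γ.map fun w => (w.1.1, w.2)) (And.intro ?_ ?_)).trans ?_
  · rw [Measure.map_map measurable_fst hm', ← h₁.1, ← hγ₁,
      Measure.map_map measurable_fst measurable_fst]
    rfl
  · rw [Measure.map_map measurable_snd hm', ← h₂.2, ← hγ₂, Measure.map_map measurable_snd hm]
    rfl
  · rw [transportCost, lintegral_map (measurable_edist_rpow p) hm', e₁, e₂]
    refine le_trans ?_ (ENNReal.lintegral_Lp_add_le (μ := γ) (p := p)
      (f := fun w => edist w.1.1 w.1.2) (g := fun w => edist w.1.2 w.2) ?_ ?_ hp)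
    · refine ENNReal.rpow_le_rpow (lintegral_mono fun w => ?_) (by positivity)
      exact ENNReal.rpow_le_rpow (edist_triangle _ _ _) hp0.le
    · exact (measurable_edist.comp measurable_fst).aemeasurable
    · exact (measurable_edist.comp hm).aemeasurable

theorem measure_le_of_wassersteinEDist_eq_zero {p : ℝ} (hp : 0 < p) {μ ν : Measure X}
    [IsFiniteMeasure ν] (h : wassersteinEDist p μ ν = 0) {F : Set X} (hF : IsClosed F) :
    μ F ≤ ν F := by
  have h0 : ⨅ (π : Measure (X × X)) (_ : IsTransportPlan π μ ν), transportCost p π = 0 := by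
    simpa [wassersteinEDist, ENNReal.rpow_eq_zero_iff, hp, hp.le, not_lt.2 hp.le] using h
  have key : ∀ δ : ℝ, 0 < δ → μ F ≤ ν (Metric.cthickening δ F) := by
    intro δ hδ
    have hδ' : ENNReal.ofReal δ ^ p ≠ 0 := by simp [ENNReal.rpow_eq_zero_iff, hδ]
    have hδt : ENNReal.ofReal δ ^ p ≠ ∞ := ENNReal.rpow_ne_top_of_nonneg hp.le (by simp)
    refine ENNReal.le_of_forall_pos_le_add fun ε hε _ => ?_
    have hpos : (⨅ (π : Measure (X × X)) (_ : IsTransportPlan π μ ν), transportCost p π) <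
        ε * ENNReal.ofReal δ ^ p := by
      rw [h0]; exact ENNReal.mul_pos (by simpa using hε.ne') hδ'
    simp only [iInf_lt_iff] at hpos
    obtain ⟨π, hπ, hc⟩ := hpos
    have hmarkov := mul_meas_ge_le_lintegral (μ := π) (measurable_edist_rpow (X := X) p)
      (ENNReal.ofReal δ ^ p)
    have hbad : π {z | ENNReal.ofReal δ ^ p ≤ edist z.1 z.2 ^ p} ≤ ε := by
      have := hmarkov.trans hc.le
      rw [mul_comm] at this
      exact (ENNReal.mul_le_mul_iff_left hδ' hδt).1 this
    calc μ F = π (Prod.fst ⁻¹' F) := by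
          rw [← hπ.1, Measure.map_apply measurable_fst hF.measurableSet]
      _ ≤ π (Prod.snd ⁻¹' Metric.cthickening δ F ∪
            {z | ENNReal.ofReal δ ^ p ≤ edist z.1 z.2 ^ p}) := by
          refine measure_mono fun z hz => ?_
          by_cases hd : ENNReal.ofReal δ ≤ edist z.1 z.2
          · exact Or.inr (ENNReal.rpow_le_rpow hd hp.le)
          · refine Or.inl (Metric.mem_cthickening_of_edist_le z.2 z.1 δ F hz ?_)
            rw [edist_comm]; exact (not_le.1 hd).le
      _ ≤ π (Prod.snd ⁻¹' Metric.cthickening δ F) + ε :=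
          (measure_union_le _ _).trans (by gcongr)
      _ = ν (Metric.cthickening δ F) + ε := by
          rw [← hπ.2, Measure.map_apply measurable_snd Metric.isClosed_cthickening.measurableSet]
  have hlim := tendsto_measure_cthickening_of_isClosed (μ := ν) (s := F)
    ⟨1, one_pos, measure_ne_top _ _⟩ hF
  refine ge_of_tendsto (hlim.mono_left (nhdsWithin_le_nhds (s := Set.Ioi 0))) ?_
  filter_upwards [self_mem_nhdsWithin] with δ hδ using key δ hδ

theorem eq_of_wassersteinEDist_eq_zero {p : ℝ} (hp : 0 < p) {μ ν : Measure X}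
    [IsFiniteMeasure μ] [IsFiniteMeasure ν] (h : wassersteinEDist p μ ν = 0) : μ = ν := by
  have h' : wassersteinEDist p ν μ = 0 :=
    nonpos_iff_eq_zero.1 ((wassersteinEDist_comm_le hp ν μ).trans_eq h)
  have hc : ∀ F : Set X, IsClosed F → μ F = ν F := fun F hF =>
    le_antisymm (measure_le_of_wassersteinEDist_eq_zero hp h hF)
      (measure_le_of_wassersteinEDist_eq_zero hp h' hF)
  refine ext_of_generate_finite _ (BorelSpace.measurable_eq.trans borel_eq_generateFrom_isClosed)
    isPiSystem_isClosed (fun F hF => hc F hF) (hc _ isClosed_univ)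

/-- The metric space `W_p(X)`. -/
instance (p : ℝ) [hp : Fact (1 ≤ p)] : EMetricSpace (WassersteinSpace p X) where
  edist μ ν := wassersteinEDist p (μ.toProbabilityMeasure : Measure X) ν.toProbabilityMeasure
  edist_self _ := wassersteinEDist_self (zero_lt_one.trans_le hp.out) _
  edist_comm _ _ := le_antisymm (wassersteinEDist_comm_le (zero_lt_one.trans_le hp.out) _ _)
    (wassersteinEDist_comm_le (zero_lt_one.trans_le hp.out) _ _)
  edist_triangle _ _ _ := wassersteinEDist_triangle hp.out _ _ _
  eq_of_edist_eq_zero {μ ν} h := by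
    obtain ⟨μ⟩ := μ
    obtain ⟨ν⟩ := ν
    have h' : wassersteinEDist p (μ : Measure X) (ν : Measure X) = 0 := h
    have he : (μ : Measure X) = ν :=
      eq_of_wassersteinEDist_eq_zero (zero_lt_one.trans_le hp.out) h'
    exact congrArg _ (Subtype.ext he)

end Metric

/-! ### The power-exponential critical parameter -/

/-- The gauge `r ↦ exp (-1 / r ^ s)`, with its limit value `0` at `r = 0`. -/
def powerExpGauge (s : ℝ) (r : ℝ≥0∞) : ℝ≥0∞ :=
  EReal.exp (-(((r ^ s)⁻¹ : ℝ≥0∞) : EReal))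

/-- The power-exponential critical parameter of a metric space: the definition of the Hausdorff
dimension, with the gauges `r ↦ exp (-1 / r ^ s)`, `s > 0`, in the place of `r ↦ r ^ s`. -/
def powerExpCrit (X : Type*) [EMetricSpace X] : ℝ≥0∞ :=
  ⨆ (s : ℝ≥0) (_ : 0 < s)
    (_ : OuterMeasure.mkMetric (powerExpGauge s) (Set.univ : Set X) = ∞), (s : ℝ≥0∞)

/-! ### Regular ultrametric spaces -/

/-- The points of the regular ultrametric space `Y(k, q)`: infinite words on `k` letters. -/
@[ext]
structure RegularUltrametric (k : ℕ) (q : ℝ) where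
  /-- The letters of the word. -/
  word : ℕ → Fin k

namespace RegularUltrametric

variable {k : ℕ} {q : ℝ}

/-- The distance `q ^ (-min {i | x i ≠ y i})` of `Y(k, q)`. The letters of a word are numbered
from one, whence the shift by one: `PiNat.firstDiff` numbers them from zero. -/
def wordDist (x y : RegularUltrametric k q) : ℝ :=
  open Classical in
  if x = y then 0 else (q ^ (PiNat.firstDiff x.word y.word + 1))⁻¹

theorem wordDist_of_ne {x y : RegularUltrametric k q} (h : x ≠ y) :
    wordDist x y = (q ^ (PiNat.firstDiff x.word y.word + 1))⁻¹ := if_neg h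

theorem wordDist_self (x : RegularUltrametric k q) : wordDist x x = 0 := if_pos rfl

theorem wordDist_comm (x y : RegularUltrametric k q) : wordDist x y = wordDist y x := by
  by_cases h : x = y
  · rw [h]
  · rw [wordDist_of_ne h, wordDist_of_ne (Ne.symm h), PiNat.firstDiff_comm]

theorem wordDist_nonneg (hq : 1 < q) (x y : RegularUltrametric k q) : 0 ≤ wordDist x y := by
  unfold wordDist
  have : 0 < q := by linarith
  split_ifs <;> positivity

theorem wordDist_le_max (hq : 1 < q) (x y z : RegularUltrametric k q) :
    wordDist x z ≤ max (wordDist x y) (wordDist y z) := by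
  by_cases hxz : x = z
  · subst hxz
    rw [wordDist_self]; exact le_max_of_le_left (wordDist_nonneg hq _ _)
  by_cases hxy : x = y
  · subst hxy; exact le_max_right _ _
  by_cases hyz : y = z
  · subst hyz; exact le_max_left _ _
  have hq0 : 0 < q := by linarith
  rw [wordDist_of_ne hxz, wordDist_of_ne hxy, wordDist_of_ne hyz]
  rcases min_le_iff.1 (PiNat.min_firstDiff_le x.word y.word z.word (mt RegularUltrametric.ext hxz)) with h | h
  · refine le_max_of_le_left (inv_anti₀ (by positivity) (pow_le_pow_right₀ hq.le ?_))
    exact Nat.succ_le_succ h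
  · refine le_max_of_le_right (inv_anti₀ (by positivity) (pow_le_pow_right₀ hq.le ?_))
    exact Nat.succ_le_succ h

instance [hq : Fact (1 < q)] : MetricSpace (RegularUltrametric k q) where
  dist := wordDist
  dist_self := wordDist_self
  dist_comm := wordDist_comm
  dist_triangle x y z := (wordDist_le_max hq.out x y z).trans
    (max_le_add_of_nonneg (wordDist_nonneg hq.out _ _) (wordDist_nonneg hq.out _ _))
  eq_of_dist_eq_zero {x y} h := by
    by_contra hne
    have hq0 : 0 < q := zero_lt_one.trans hq.out
    have h' : wordDist x y = 0 := h
    rw [wordDist_of_ne hne] at h'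
    exact (by positivity : (q ^ (PiNat.firstDiff x.word y.word + 1))⁻¹ ≠ 0) h'

theorem dist_eq [Fact (1 < q)] (x y : RegularUltrametric k q) : dist x y = wordDist x y := rfl

instance [Fact (1 < q)] : MeasurableSpace (RegularUltrametric k q) := borel _

instance [Fact (1 < q)] : BorelSpace (RegularUltrametric k q) := ⟨rfl⟩

theorem continuous_mk [hq : Fact (1 < q)] :
    Continuous (RegularUltrametric.mk : (ℕ → Fin k) → RegularUltrametric k q) := by
  have hq1 : 1 < q := hq.out
  rw [continuous_iff_continuousAt]
  intro x
  refine Metric.tendsto_nhds.2 fun ε hε => ?_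
  obtain ⟨n, hn⟩ := exists_pow_lt_of_lt_one hε (inv_lt_one_of_one_lt₀ hq1)
  have hU := (PiNat.isOpen_cylinder (fun _ => Fin k) x n).mem_nhds (PiNat.self_mem_cylinder x n)
  filter_upwards [hU] with y hy
  by_cases hne : y = x
  · subst hne; simpa using hε
  · have hle : n ≤ PiNat.firstDiff y x := (PiNat.mem_cylinder_iff_le_firstDiff hne n).1 hy
    refine lt_of_le_of_lt ?_ hn
    rw [dist_eq, wordDist_of_ne (mt (congrArg RegularUltrametric.word) hne), inv_pow]
    exact inv_anti₀ (by positivity) (pow_le_pow_right₀ hq1.le (by simp only; omega))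

instance [Fact (1 < q)] : CompactSpace (RegularUltrametric k q) := by
  refine ⟨?_⟩
  have h := isCompact_univ.image (continuous_mk (k := k) (q := q))
  rwa [Set.image_univ_of_surjective fun x => ⟨x.word, rfl⟩] at h

end RegularUltrametric

end

/-! At scale `q^{-n}` a probability measure on `Y` is a vector of `k^n` cylinder masses, so `W_p(Y)`
takes about `exp(k^n)` sets of diameter comparable to `q^{-n}` to cover, up to a factor linear in
`n` in the exponent. The gauge at that size is about `exp(-q^{sn})`, and the two balance at `q^s =
k`.

Upper bound (`mkMetric_wassersteinSpace_eq_zero`). Rounding the cylinder masses to a grid of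
exponentially small step gives at most `exp(L (n+1) k^n)` cells of diameter at most `3 q^{-n}`
(`ediam_approxCell_le`). If `k < q^s`, the gauge sums over these covers tend to `0`.

Lower bound (`mkMetric_wassersteinSpace_eq_top`). Each of the `k^n` words of length `n` gets a sign,
which chooses between two next letters. The sign patterns of level `n` are taken from a binary code
with at least `(4/3)^{k^n}` elements, any two of which differ on a fixed proportion of the words
(`exists_code`). Level `n` enters with weight proportional to `θ^n`. If two families of signs first
differ at level `m`, finer levels cannot compensate, and mass of order `θ^m` must travel at least
`q^{-(m+1)}` (`le_wassersteinEDist_signMeasure`). So a product of finite sets embeds in `W_p(Y)`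
with separation of order `t^{-m}`, where `t = q θ^{-1/p}` can be any number above `q`. If `q^s < k`,
some such `t` has `t^s < k`. The mass distribution principle (`le_mkMetric_univ_of_separated`) for
the uniform product measure then gives an infinite value, since `(4/3)^{-k^n}` is negligible against
`exp(-L t^{sn})`.

The same principle, applied to `Y` itself with `r ↦ r ^ log_q k`, gives the lower bound for the
Hausdorff dimension. -/

noncomputable section

open Filter Topology

/-! ### Lower bounds for Carathéodory measures by product measures -/

section Product

variable {S : ℕ → Type*} [∀ n, Fintype (S n)] [∀ n, Nonempty (S n)]
  [∀ n, MeasurableSpace (S n)] [∀ n, MeasurableSingletonClass (S n)]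

/-- The product of the uniform probability measures on a sequence of finite sets. -/
def uniformProduct (S : ℕ → Type*) [∀ n, Fintype (S n)] [∀ n, Nonempty (S n)]
    [∀ n, MeasurableSpace (S n)] [∀ n, MeasurableSingletonClass (S n)] : Measure (∀ n, S n) :=
  Measure.infinitePi fun n => ProbabilityTheory.uniformOn (Set.univ : Set (S n))

instance : IsProbabilityMeasure (uniformProduct S) := by
  unfold uniformProduct; infer_instance

/-- A set of sequences with common coordinates up to `n` has at most the measure of the
corresponding cylinder. -/
theorem uniformProduct_le (U : Set (∀ n, S n)) (n : ℕ)
    (h : ∀ x ∈ U, ∀ y ∈ U, ∀ m ≤ n, x m = y m) :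
    uniformProduct S U ≤ ∏ m ∈ Finset.range (n + 1), (Fintype.card (S m) : ℝ≥0∞)⁻¹ := by
  rcases U.eq_empty_or_nonempty with rfl | ⟨x, hx⟩
  · simp
  calc uniformProduct S U
      ≤ uniformProduct S ((Finset.range (n + 1) : Set ℕ).pi fun m => {x m}) := by
        refine measure_mono fun y hy m hm => ?_
        exact h y hy x hx m (Nat.lt_succ_iff.1 (Finset.mem_range.1 hm))
    _ = ∏ m ∈ Finset.range (n + 1), (Fintype.card (S m) : ℝ≥0∞)⁻¹ := by
        rw [uniformProduct, Measure.infinitePi_pi _ fun m _ => measurableSet_singleton _]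
        refine Finset.prod_congr rfl fun m _ => ?_
        rw [ProbabilityTheory.uniformOn_univ, Measure.count_singleton, one_div]

/-- Mass distribution principle: if a map from a product of finite sets separates the points which
differ at a coordinate up to `n` by at least `r n`, then the Carathéodory measure of the
target is bounded below by comparing the gauge with the measures of cylinders. -/
theorem le_mkMetric_univ_of_separated {X : Type*} [EMetricSpace X] (Φ : (∀ n, S n) → X)
    (r : ℕ → ℝ≥0∞) (hΦ : ∀ x y n m, m ≤ n → x m ≠ y m → r n ≤ edist (Φ x) (Φ y))
    (hr0 : ∀ n, 0 < r n) (hanti : StrictAnti r)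
    {g : ℝ≥0∞ → ℝ≥0∞} (hg : Monotone g) (hg0 : Tendsto (fun n => g (r n)) atTop (𝓝 0))
    {C : ℝ≥0∞}
    (hle : ∀ᶠ n in atTop,
      C * ∏ m ∈ Finset.range (n + 1), (Fintype.card (S m) : ℝ≥0∞)⁻¹ ≤ g (r (n + 1))) :
    C ≤ OuterMeasure.mkMetric g (Set.univ : Set X) := by
  obtain ⟨n₀, hn₀⟩ := eventually_atTop.1 hle
  have hU : ∀ (U : Set X) n, Metric.ediam U < r n → C * uniformProduct S (Φ ⁻¹' U) ≤
      C * ∏ m ∈ Finset.range (n + 1), (Fintype.card (S m) : ℝ≥0∞)⁻¹ := by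
    intro U n hd
    gcongr
    refine uniformProduct_le _ n fun x hx y hy m hm => ?_
    by_contra hne
    exact absurd (hΦ x y n m hm hne)
      (not_le.2 ((Metric.edist_le_ediam_of_mem (s := U) hx hy).trans_lt hd))
  -- Outer measures push forward along arbitrary maps, so `Φ` need not be measurable.
  let P : OuterMeasure X := OuterMeasure.map Φ (uniformProduct S).toOuterMeasure
  have hP : C • P ≤ OuterMeasure.mkMetric g := by
    refine OuterMeasure.le_mkMetric g _ (r (n₀ + 1)) (hr0 _) fun U hd => ?_
    have hsmall : ∀ n ≤ n₀, Metric.ediam U < r n := fun n hn =>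
      hd.trans_lt (hanti (Nat.lt_succ_of_le hn))
    change C * uniformProduct S (Φ ⁻¹' U) ≤ g (Metric.ediam U)
    -- The least such index exceeds `n₀`, so it has a predecessor `n₀ + n`. At the predecessor the
    -- diameter is still below `r`, which confines `Φ ⁻¹' U` to a cylinder; at the index itself the
    -- gauge of the diameter is at least `g (r _)`.
    by_cases hex : ∃ n, r n ≤ Metric.ediam U
    · classical
      have hspec := Nat.find_spec hex
      have hmin : ∀ n < Nat.find hex, Metric.ediam U < r n := fun n hn =>
        not_le.1 (Nat.find_min hex hn)
      have hlt : n₀ < Nat.find hex := by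
        by_contra! hcon
        exact absurd hspec (not_le.2 (hsmall _ hcon))
      obtain ⟨n, hn⟩ := Nat.exists_eq_add_of_lt hlt
      rw [hn] at hspec hmin
      exact (hU U (n₀ + n) (hmin _ (Nat.lt_succ_self _))).trans
        ((hn₀ _ (Nat.le_add_right _ _)).trans (hg hspec))
    -- Here the preimage lies in cylinders of every length, so its weighted measure is below `g (r
    -- (n + 1))` for all large `n`, hence zero.
    · push Not at hex
      have hz : C * uniformProduct S (Φ ⁻¹' U) ≤ 0 := by
        refine ge_of_tendsto ((tendsto_add_atTop_iff_nat 1).2 hg0) ?_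
        filter_upwards [hle] with n hn using (hU U n (hex n)).trans hn
      exact hz.trans zero_le
  calc C = (C • P) Set.univ := by
        change C = C * uniformProduct S (Φ ⁻¹' Set.univ)
        simp
    _ ≤ _ := hP _

end Product

/-! ### Binary codes -/

section Codes

variable {ι : Type*} [Fintype ι] [DecidableEq ι]

theorem sum_pow_hammingDist (z : ℝ) (x : ι → Bool) :
    ∑ y : ι → Bool, z ^ hammingDist x y = (1 + z) ^ Fintype.card ι := by
  have h : ∀ y : ι → Bool, z ^ hammingDist x y = ∏ i, if x i = y i then 1 else z := by
    intro y
    rw [Finset.prod_ite, Finset.prod_const_one, one_mul, Finset.prod_const]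
    rfl
  simp only [h]
  rw [← Fintype.piFinset_univ, ← Finset.prod_univ_sum (fun _ => Finset.univ)
    (fun i b => if x i = b then (1 : ℝ) else z)]
  have : ∀ i, ∑ b : Bool, (if x i = b then (1 : ℝ) else z) = 1 + z := by
    intro i
    cases x i <;> simp [add_comm]
  simp only [this, Finset.prod_const, Finset.card_univ]

/-- The number of words at relative distance less than `1 / 8` of a given one. -/
theorem card_hammingBall_le (x : ι → Bool) :
    ((Finset.univ.filter fun y => 8 * hammingDist x y < Fintype.card ι).card : ℝ) ≤
      (3 / 2) ^ Fintype.card ι := by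
  set N := Fintype.card ι
  -- Chernoff's argument with `z = (3/4)^8`: on the ball the exponent `8 * hammingDist x y` is less
  -- than `N`, so each term is at least `(3/4)^N`.
  have h1 : ((Finset.univ.filter fun y => 8 * hammingDist x y < N).card : ℝ) * (3 / 4) ^ N ≤
      (1 + (3 / 4) ^ 8) ^ N := by
    rw [← sum_pow_hammingDist _ x, ← nsmul_eq_mul, ← Finset.sum_const]
    calc _ ≤ ∑ y ∈ Finset.univ.filter fun y => 8 * hammingDist x y < N,
          (((3 : ℝ) / 4) ^ 8) ^ hammingDist x y := by
          refine Finset.sum_le_sum fun y hy => ?_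
          rw [← pow_mul]
          exact pow_le_pow_of_le_one (by norm_num) (by norm_num) (Finset.mem_filter.1 hy).2.le
      _ ≤ _ := Finset.sum_le_sum_of_subset_of_nonneg (Finset.subset_univ _)
          fun _ _ _ => by positivity
  -- This is `1 + (3/4)^8 ≤ 9/8 = (3/2)(3/4)`.
  have h2 : (1 + (3 / 4 : ℝ) ^ 8) ^ N ≤ (3 / 2) ^ N * (3 / 4) ^ N := by
    rw [← mul_pow]
    gcongr
    norm_num
  exact le_of_mul_le_mul_right (h1.trans h2) (by positivity)

/-- The Gilbert–Varshamov bound: there are exponentially large codes of relative distance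
`1 / 8`. -/
theorem exists_code (ι : Type*) [Fintype ι] [DecidableEq ι] [Nonempty ι] :
    ∃ S : Finset (ι → Bool),
      (∀ x ∈ S, ∀ y ∈ S, x ≠ y → Fintype.card ι ≤ 8 * hammingDist x y) ∧
        (4 / 3 : ℝ) ^ Fintype.card ι ≤ S.card := by
  set N := Fintype.card ι
  obtain ⟨S, hS⟩ := Set.Finite.exists_maximal
    (s := {S : Finset (ι → Bool) | ∀ x ∈ S, ∀ y ∈ S, x ≠ y → N ≤ 8 * hammingDist x y})
    (Set.toFinite _) ⟨∅, by simp⟩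
  refine ⟨S, hS.prop, ?_⟩
  -- The balls around a maximal code cover the cube: an uncovered word could be added to the code.
  -- Counting then gives the factor `2 / (3/2) = 4/3`.
  have hcov : (Finset.univ : Finset (ι → Bool)) ⊆
      S.biUnion fun x => Finset.univ.filter fun y => 8 * hammingDist x y < N := by
    intro y _
    by_contra hy
    have hfar : ∀ x ∈ S, N ≤ 8 * hammingDist x y := by
      intro x hx
      by_contra! hlt
      exact hy (Finset.mem_biUnion.2 ⟨x, hx, Finset.mem_filter.2 ⟨Finset.mem_univ _, hlt⟩⟩)
    have hins : insert y S ∈ {S : Finset (ι → Bool) |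
        ∀ x ∈ S, ∀ y ∈ S, x ≠ y → N ≤ 8 * hammingDist x y} := by
      intro a ha b hb hab
      rcases Finset.mem_insert.1 ha with rfl | ha' <;> rcases Finset.mem_insert.1 hb with rfl | hb'
      · exact absurd rfl hab
      · rw [hammingDist_comm]; exact hfar b hb'
      · exact hfar a ha'
      · exact hS.prop a ha' b hb' hab
    have hyS : y ∈ S := hS.le_of_ge hins (Finset.subset_insert y S) (Finset.mem_insert_self y S)
    have h0 := hfar y hyS
    rw [hammingDist_self] at h0
    have hN : 0 < N := Fintype.card_pos
    omega
  have hcard : (2 : ℝ) ^ N ≤ S.card * (3 / 2) ^ N := by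
    calc (2 : ℝ) ^ N = ((Finset.univ : Finset (ι → Bool)).card : ℝ) := by
          simp [N]
      _ ≤ ∑ x ∈ S, ((Finset.univ.filter fun y => 8 * hammingDist x y < N).card : ℝ) := by
          exact_mod_cast (Finset.card_le_card hcov).trans Finset.card_biUnion_le
      _ ≤ ∑ x ∈ S, (3 / 2 : ℝ) ^ N := Finset.sum_le_sum fun x _ => card_hammingBall_le x
      _ = _ := by simp
  have h3 : (2 : ℝ) ^ N = (4 / 3) ^ N * (3 / 2) ^ N := by
    rw [← mul_pow]; norm_num
  rw [h3] at hcard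
  exact le_of_mul_le_mul_right hcard (by positivity)

end Codes

/-! ### The power-exponential gauge -/

theorem powerExpGauge_mono {s : ℝ} (hs : 0 ≤ s) : Monotone (powerExpGauge s) := by
  intro a b hab
  refine EReal.exp_monotone (EReal.neg_le_neg_iff.2 ?_)
  exact_mod_cast ENNReal.inv_le_inv.2 (ENNReal.rpow_le_rpow hab hs)

theorem powerExpGauge_ofReal (s : ℝ) {r : ℝ} (hr : 0 < r) :
    powerExpGauge s (ENNReal.ofReal r) = ENNReal.ofReal (Real.exp (-(r ^ s)⁻¹)) := by
  have hpos : 0 < r ^ s := Real.rpow_pos_of_pos hr s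
  rw [powerExpGauge, ENNReal.ofReal_rpow_of_pos hr, ← ENNReal.ofReal_inv_of_pos hpos,
    EReal.coe_ennreal_ofReal, max_eq_left (by positivity), ← EReal.coe_neg, EReal.exp_coe]

theorem tendsto_powerExpGauge {s : ℝ} (hs : 0 < s) {r : ℕ → ℝ} (hr0 : ∀ n, 0 < r n)
    (hr : Tendsto r atTop (𝓝 0)) :
    Tendsto (fun n => powerExpGauge s (ENNReal.ofReal (r n))) atTop (𝓝 0) := by
  simp only [powerExpGauge_ofReal s (hr0 _)]
  rw [← ENNReal.ofReal_zero]
  refine ENNReal.tendsto_ofReal (Real.tendsto_exp_atBot.comp (tendsto_neg_atTop_atBot.comp ?_))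
  refine Tendsto.inv_tendsto_nhdsGT_zero (tendsto_nhdsWithin_iff.2 ⟨?_, ?_⟩)
  · have := hr.rpow_const (p := s) (Or.inr hs.le)
    rwa [Real.zero_rpow hs.ne'] at this
  · exact Eventually.of_forall fun n => Real.rpow_pos_of_pos (hr0 n) s

/-! ### Cylinders of the regular ultrametric spaces -/

namespace RegularUltrametric

variable {k : ℕ} {q : ℝ}

/-- The first `n` letters of a word. -/
def initial (n : ℕ) (x : RegularUltrametric k q) : Fin n → Fin k := fun i => x.word i

theorem initial_eq_iff {n : ℕ} {x y : RegularUltrametric k q} :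
    x.initial n = y.initial n ↔ ∀ i < n, x.word i = y.word i :=
  ⟨fun h i hi => congrFun h ⟨i, hi⟩, fun h => funext fun i => h i i.2⟩

theorem initial_eq_of_le {m n : ℕ} (hmn : m ≤ n) {x y : RegularUltrametric k q}
    (h : x.initial n = y.initial n) : x.initial m = y.initial m :=
  initial_eq_iff.2 fun i hi => initial_eq_iff.1 h i (hi.trans_le hmn)

variable [hq : Fact (1 < q)]

theorem edist_eq (x y : RegularUltrametric k q) : edist x y = ENNReal.ofReal (wordDist x y) := by
  rw [edist_dist, dist_eq]

theorem edist_le_of_initial_eq {n : ℕ} {x y : RegularUltrametric k q}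
    (h : x.initial n = y.initial n) : edist x y ≤ ENNReal.ofReal (q⁻¹ ^ (n + 1)) := by
  have hq1 := hq.out
  rw [edist_eq]
  by_cases hxy : x = y
  · rw [hxy, wordDist_self]; simp
  · have hw : x.word ≠ y.word := mt RegularUltrametric.ext hxy
    have hn : n ≤ PiNat.firstDiff x.word y.word := by
      by_contra! hlt
      exact PiNat.apply_firstDiff_ne hw (initial_eq_iff.1 h _ hlt)
    rw [wordDist_of_ne hxy, inv_pow]
    exact ENNReal.ofReal_le_ofReal
      (inv_anti₀ (by positivity) (pow_le_pow_right₀ hq1.le (by omega)))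

theorem le_edist_of_initial_ne {n : ℕ} {x y : RegularUltrametric k q}
    (h : x.initial n ≠ y.initial n) : ENNReal.ofReal (q⁻¹ ^ n) ≤ edist x y := by
  have hq1 := hq.out
  have hxy : x ≠ y := fun e => h (e ▸ rfl)
  have hn : PiNat.firstDiff x.word y.word < n := by
    by_contra! hle
    exact h (initial_eq_iff.2 fun i hi => PiNat.apply_eq_of_lt_firstDiff (hi.trans_le hle))
  rw [edist_eq, wordDist_of_ne hxy, inv_pow]
  exact ENNReal.ofReal_le_ofReal
    (inv_anti₀ (by positivity) (pow_le_pow_right₀ hq1.le (by omega)))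

theorem edist_le_one (x y : RegularUltrametric k q) : edist x y ≤ 1 := by
  have hq1 := hq.out
  refine (edist_le_of_initial_eq (n := 0) (funext fun i => i.elim0)).trans ?_
  rw [← ENNReal.ofReal_one]
  exact ENNReal.ofReal_le_ofReal (pow_le_one₀ (by positivity) (inv_le_one_of_one_le₀ hq1.le))

/-- A set which is determined by the first `n` letters is open. -/
theorem isOpen_of_initial {n : ℕ} {F : Set (RegularUltrametric k q)}
    (hF : ∀ x y, x.initial n = y.initial n → x ∈ F → y ∈ F) : IsOpen F := by
  have hq0 : 0 < q := zero_lt_one.trans hq.out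
  refine EMetric.isOpen_iff.2 fun x hx =>
    ⟨ENNReal.ofReal (q⁻¹ ^ n), ENNReal.ofReal_pos.2 (by positivity), fun y hy => ?_⟩
  refine hF x y ?_ hx
  by_contra hne
  refine absurd (le_edist_of_initial_ne hne) (not_le.2 ?_)
  rw [edist_comm]; exact hy

theorem measurableSet_of_initial {n : ℕ} {F : Set (RegularUltrametric k q)}
    (hF : ∀ x y, x.initial n = y.initial n → x ∈ F → y ∈ F) : MeasurableSet F :=
  (isOpen_of_initial hF).measurableSet

theorem tendsto_inv_pow (n : ℕ) :
    Tendsto (fun m : ℕ => ENNReal.ofReal (q⁻¹ ^ (m + n))) atTop (𝓝 0) := by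
  have hq0 : 0 < q := zero_lt_one.trans hq.out
  rw [← ENNReal.ofReal_zero]
  exact ENNReal.tendsto_ofReal ((tendsto_add_atTop_iff_nat n).2
    (tendsto_pow_atTop_nhds_zero_of_lt_one (by positivity) (inv_lt_one_of_one_lt₀ hq.out)))

/-! ### The Hausdorff dimension -/

theorem ofReal_pow_rpow_logb (hk : 1 ≤ k) (n : ℕ) :
    ENNReal.ofReal (q⁻¹ ^ n) ^ Real.logb q k = ENNReal.ofReal ((k : ℝ)⁻¹ ^ n) := by
  have hq0 : 0 < q := zero_lt_one.trans hq.out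
  have hk0 : (0 : ℝ) < k := by exact_mod_cast hk
  rw [ENNReal.ofReal_rpow_of_pos (by positivity), ← Real.rpow_natCast, ← Real.rpow_mul
    (by positivity), mul_comm, Real.rpow_mul (by positivity), Real.inv_rpow hq0.le,
    Real.rpow_logb hq0 hq.out.ne' hk0, Real.rpow_natCast]

/-- With the exponent `log_q k`, a cylinder of length `n` has gauge at most `k^{-(n+1)}`, and there
are `k^n` of them, so the measure is finite. The uniform measure on words gives positivity by the
mass distribution principle. -/
theorem dimH_univ (hk : 1 ≤ k) :
    dimH (Set.univ : Set (RegularUltrametric k q)) = ENNReal.ofReal (Real.logb q k) := by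
  have hq1 := hq.out
  have hq0 : 0 < q := zero_lt_one.trans hq1
  have hk0 : (0 : ℝ) < k := by exact_mod_cast hk
  have hD : 0 ≤ Real.logb q k := Real.logb_nonneg hq1 (by exact_mod_cast hk)
  refine le_antisymm ?_ ?_
  · refine dimH_le_of_hausdorffMeasure_ne_top (d := (Real.logb q k).toNNReal) ?_
    rw [Real.coe_toNNReal _ hD]
    have hdiam : ∀ (n : ℕ) (u : Fin n → Fin k),
        Metric.ediam {x : RegularUltrametric k q | x.initial n = u} ≤
          ENNReal.ofReal (q⁻¹ ^ (n + 1)) := fun n u =>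
      Metric.ediam_le fun x hx y hy => edist_le_of_initial_eq (Eq.trans hx (Eq.symm hy))
    refine ne_top_of_le_ne_top ENNReal.one_ne_top ((Measure.hausdorffMeasure_le_liminf_sum _ _ _
      (tendsto_inv_pow 1) (fun n (u : Fin n → Fin k) =>
        {x : RegularUltrametric k q | x.initial n = u}) (Eventually.of_forall hdiam)
      (Eventually.of_forall fun n x _ => Set.mem_iUnion.2 ⟨x.initial n, rfl⟩)).trans ?_)
    refine (liminf_le_liminf (Eventually.of_forall fun n => ?_)).trans_eq
      (liminf_const (f := (atTop : Filter ℕ)) (1 : ℝ≥0∞))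
    calc ∑ u : Fin n → Fin k, Metric.ediam {x : RegularUltrametric k q | x.initial n = u} ^
          Real.logb q k ≤ ∑ u : Fin n → Fin k, ENNReal.ofReal ((k : ℝ)⁻¹ ^ (n + 1)) := by
          refine Finset.sum_le_sum fun u _ => ?_
          rw [← ofReal_pow_rpow_logb (q := q) hk]
          exact ENNReal.rpow_le_rpow (hdiam n u) hD
      _ = ENNReal.ofReal ((k : ℝ) ^ n * (k : ℝ)⁻¹ ^ (n + 1)) := by
          rw [ENNReal.ofReal_mul (by positivity)]
          simp [ENNReal.ofReal_pow]
      _ ≤ 1 := by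
          rw [← ENNReal.ofReal_one, pow_succ, ← mul_assoc, ← mul_pow, mul_inv_cancel₀ hk0.ne',
            one_pow, one_mul]
          exact ENNReal.ofReal_le_ofReal (inv_le_one_of_one_le₀ (by exact_mod_cast hk))
  -- For `k = 1` the exponent is `0` and the gauge no longer tends to `0` at small scales, but the
  -- bound is trivial.
  · rcases hk.eq_or_lt with rfl | hk2
    · simp
    have hD' : 0 < Real.logb q k := Real.logb_pos hq1 (by exact_mod_cast hk2)
    refine le_dimH_of_hausdorffMeasure_ne_zero (d := (Real.logb q k).toNNReal) ?_
    rw [Real.coe_toNNReal _ hD]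
    have : Nonempty (Fin k) := ⟨⟨0, hk⟩⟩
    have hlow : ENNReal.ofReal (k : ℝ)⁻¹ ≤ OuterMeasure.mkMetric (fun r => r ^ Real.logb q k)
        (Set.univ : Set (RegularUltrametric k q)) := by
      refine le_mkMetric_univ_of_separated (S := fun _ => Fin k) RegularUltrametric.mk
        (fun n => ENNReal.ofReal (q⁻¹ ^ (n + 1))) ?_ ?_ ?_ ?_ ?_ ?_
      · intro x y n m hmn hne
        exact le_edist_of_initial_ne fun h => hne (initial_eq_iff.1 h m (Nat.lt_succ_of_le hmn))
      · intro n; exact ENNReal.ofReal_pos.2 (by positivity)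
      · refine strictAnti_nat_of_succ_lt fun n => ?_
        rw [ENNReal.ofReal_lt_ofReal_iff (by positivity)]
        exact pow_lt_pow_right_of_lt_one₀ (by positivity) (inv_lt_one_of_one_lt₀ hq1) (by omega)
      · exact fun a b hab => ENNReal.rpow_le_rpow hab hD
      · have := (ENNReal.continuous_rpow_const (y := Real.logb q k)).tendsto 0 |>.comp
          (tendsto_inv_pow (q := q) 1)
        rwa [ENNReal.zero_rpow_of_pos hD'] at this
      · refine Eventually.of_forall fun n => le_of_eq ?_
        rw [ofReal_pow_rpow_logb hk]
        rw [pow_succ' _ (n + 1), ENNReal.ofReal_mul (by positivity),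
          ENNReal.ofReal_pow (by positivity), ENNReal.ofReal_inv_of_pos hk0]
        simp
    rw [Measure.hausdorffMeasure, ← Measure.coe_toOuterMeasure, Measure.mkMetric_toOuterMeasure]
    exact ((ENNReal.ofReal_pos.2 (by positivity)).trans_le hlow).ne'

end RegularUltrametric

/-! ### Upper bounds for the Wasserstein distance -/

section WassersteinUpper

variable {X : Type*} [MetricSpace X] [CompactSpace X] [MeasurableSpace X] [BorelSpace X]

theorem wassersteinEDist_le_of_plan {p : ℝ} (hp : 0 < p) {μ ν : Measure X} {π : Measure (X × X)}
    (hπ : IsTransportPlan π μ ν) : wassersteinEDist p μ ν ≤ transportCost p π ^ (1 / p) := by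
  rw [wassersteinEDist_eq_iInf hp]
  exact iInf₂_le π hπ

/-- A map which moves points by at most `r` moves probability measures by at most `r`. -/
theorem wassersteinEDist_map_le {p : ℝ} (hp : 0 < p) (μ : Measure X) [IsProbabilityMeasure μ]
    {T : X → X} (hT : Measurable T) {r : ℝ≥0∞} (hr : ∀ x, edist x (T x) ≤ r) :
    wassersteinEDist p μ (μ.map T) ≤ r := by
  have hm : Measurable fun x => (x, T x) := measurable_id.prodMk hT
  refine (wassersteinEDist_le_of_plan hp (π := μ.map fun x => (x, T x)) ⟨?_, ?_⟩).trans ?_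
  · rw [Measure.map_map measurable_fst hm]; exact Measure.map_id
  · rw [Measure.map_map measurable_snd hm]; rfl
  · rw [transportCost, lintegral_map (measurable_edist_rpow p) hm]
    calc (∫⁻ x, edist x (T x) ^ p ∂μ) ^ (1 / p) ≤ (∫⁻ _, r ^ p ∂μ) ^ (1 / p) :=
          ENNReal.rpow_le_rpow (lintegral_mono fun x => ENNReal.rpow_le_rpow (hr x) hp.le)
            (by positivity)
      _ = r := by
          rw [lintegral_const, measure_univ, mul_one, one_div, ENNReal.rpow_rpow_inv hp.ne']

/-- Probability measures with a common part of mass at least `1 - ε` on a space of diameter at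
most one. -/
theorem wassersteinEDist_le_of_common {p : ℝ} (hp : 0 < p) (hX : ∀ x y : X, edist x y ≤ 1)
    {κ μ ν : Measure X} [IsProbabilityMeasure μ] [IsProbabilityMeasure ν]
    (hμ : κ ≤ μ) (hν : κ ≤ ν) {ε : ℝ≥0∞} (hε : 1 ≤ κ Set.univ + ε) :
    wassersteinEDist p μ ν ≤ ε ^ (1 / p) := by
  have : IsFiniteMeasure κ := isFiniteMeasure_of_le μ hμ
  set μ' := μ - κ with hμ'
  set ν' := ν - κ with hν'
  have eμ : μ' + κ = μ := Measure.sub_add_cancel_of_le hμ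
  have eν : ν' + κ = ν := Measure.sub_add_cancel_of_le hν
  have hκ : κ Set.univ ≠ ∞ := measure_ne_top _ _
  have mμ : μ' Set.univ = 1 - κ Set.univ := by
    rw [hμ', Measure.sub_apply .univ hμ, measure_univ]
  have mν : ν' Set.univ = 1 - κ Set.univ := by
    rw [hν', Measure.sub_apply .univ hν, measure_univ]
  have hm : 1 - κ Set.univ ≤ ε := tsub_le_iff_left.2 hε
  set m := 1 - κ Set.univ with hmdef
  rcases eq_or_ne m 0 with h0 | h0
  · rw [h0, Measure.measure_univ_eq_zero] at mμ mν
    rw [← eμ, ← eν, mμ, mν, wassersteinEDist_self hp]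
    exact zero_le
  have hmt : m ≠ ∞ := ENNReal.sub_ne_top ENNReal.one_ne_top
  have hd : Measurable fun x : X => (x, x) := measurable_id.prodMk measurable_id
  -- The common part stays in place. The remainders, both of mass `m`, are coupled independently,
  -- and the normalisation `m⁻¹` is why `m = 0` was treated apart.
  refine (wassersteinEDist_le_of_plan hp
    (π := m⁻¹ • μ'.prod ν' + κ.map fun x => (x, x)) ⟨?_, ?_⟩).trans
      (ENNReal.rpow_le_rpow ?_ (by positivity))
  · rw [Measure.map_add _ _ measurable_fst, Measure.map_smul, Measure.map_fst_prod, mν,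
      Measure.map_map measurable_fst hd, smul_smul, ENNReal.inv_mul_cancel h0 hmt, one_smul]
    exact (congrArg _ Measure.map_id).trans eμ
  · rw [Measure.map_add _ _ measurable_snd, Measure.map_smul, Measure.map_snd_prod, mμ,
      Measure.map_map measurable_snd hd, smul_smul, ENNReal.inv_mul_cancel h0 hmt, one_smul]
    exact (congrArg _ Measure.map_id).trans eν
  · rw [transportCost, lintegral_add_measure, lintegral_map (measurable_edist_rpow p) hd]
    simp only [edist_self, ENNReal.zero_rpow_of_pos hp, lintegral_zero, add_zero]
    calc ∫⁻ z, edist z.1 z.2 ^ p ∂(m⁻¹ • μ'.prod ν')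
        ≤ ∫⁻ _, 1 ∂(m⁻¹ • μ'.prod ν') :=
          lintegral_mono fun z => ENNReal.rpow_le_one (hX _ _) hp.le
      _ = m := by
          rw [lintegral_const, Measure.smul_apply, ← Set.univ_prod_univ, Measure.prod_prod, mμ, mν,
            one_mul, smul_eq_mul, ← mul_assoc, ENNReal.inv_mul_cancel h0 hmt, one_mul]
      _ ≤ ε := hm

end WassersteinUpper

/-! ### Covers of the Wasserstein space -/

namespace RegularUltrametric

variable {k : ℕ} {q : ℝ}

/-- The finite word `u` followed by a constant infinite word. -/
def extend {n : ℕ} (u : Fin n → Fin k) (z : Fin k) : RegularUltrametric k q :=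
  ⟨fun i => if h : i < n then u ⟨i, h⟩ else z⟩

theorem initial_extend {n : ℕ} (u : Fin n → Fin k) (z : Fin k) :
    (extend u z : RegularUltrametric k q).initial n = u := by
  funext i
  simp [initial, extend]

variable [hq : Fact (1 < q)]

theorem measurable_initial (n : ℕ) :
    Measurable (initial n : RegularUltrametric k q → Fin n → Fin k) := fun F _ =>
  measurableSet_of_initial (n := n) fun x y h hx => by
    change y.initial n ∈ F
    rw [← h]; exact hx

/-- The probability measures whose values on the cylinders of length `n` are known up to an
error `1 / N`. -/
def approxCell (k : ℕ) (q p : ℝ) [Fact (1 < q)] (n N : ℕ) (g : (Fin n → Fin k) → Fin (N + 1)) :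
    Set (WassersteinSpace p (RegularUltrametric k q)) :=
  {μ | ∀ u, ((g u : ℕ) : ℝ≥0∞) / N ≤
      (μ.toProbabilityMeasure : Measure (RegularUltrametric k q)) (initial n ⁻¹' {u}) ∧
    (μ.toProbabilityMeasure : Measure (RegularUltrametric k q)) (initial n ⁻¹' {u}) ≤
      ((g u : ℕ) + 1 : ℝ≥0∞) / N}

theorem iUnion_approxCell (p : ℝ) (n : ℕ) {N : ℕ} (hN : 0 < N) :
    ⋃ g, approxCell k q p n N g = Set.univ := by
  refine Set.eq_univ_of_forall fun μ => Set.mem_iUnion.2 ?_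
  set m := (μ.toProbabilityMeasure : Measure (RegularUltrametric k q))
  have hN0 : (N : ℝ≥0∞) ≠ 0 := by exact_mod_cast hN.ne'
  have key : ∀ u : Fin n → Fin k, ∃ j : Fin (N + 1), ((j : ℕ) : ℝ≥0∞) / N ≤
      m (initial n ⁻¹' {u}) ∧ m (initial n ⁻¹' {u}) ≤ ((j : ℕ) + 1 : ℝ≥0∞) / N := by
    intro u
    set a := m (initial n ⁻¹' {u})
    have ha1 : a ≤ 1 := prob_le_one
    have hat : a ≠ ∞ := ne_top_of_le_ne_top ENNReal.one_ne_top ha1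
    obtain ⟨b, hb⟩ : ∃ b : ℝ≥0, a = b := ⟨a.toNNReal, (ENNReal.coe_toNNReal hat).symm⟩
    have hb1 : b ≤ 1 := by rw [hb] at ha1; exact_mod_cast ha1
    -- Mass one rounds to the index `N` itself, hence `N + 1` possible values.
    have hfl : ⌊b * N⌋₊ ≤ N := by
      refine Nat.floor_le_of_le ?_
      calc b * N ≤ 1 * N := by gcongr
        _ = N := one_mul _
    refine ⟨⟨⌊b * N⌋₊, Nat.lt_succ_of_le hfl⟩, ?_, ?_⟩
    · rw [ENNReal.div_le_iff hN0 (ENNReal.natCast_ne_top N), hb]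
      exact_mod_cast Nat.floor_le (zero_le (a := b * N))
    · rw [ENNReal.le_div_iff_mul_le (Or.inl hN0) (Or.inl (ENNReal.natCast_ne_top N)), hb]
      exact_mod_cast (Nat.lt_floor_add_one (b * N)).le
  choose g hg using key
  exact ⟨g, hg⟩

/-- Collapsing each cylinder to one of its points moves a measure by at most `q^{-(n+1)}`. The
collapsed measures of one cell all dominate the atoms `g u / N`, and what is left has mass at most
`k^n / N`. -/
theorem ediam_approxCell_le (hk : 1 ≤ k) {p : ℝ} [hp : Fact (1 ≤ p)] (n N : ℕ)
    (g : (Fin n → Fin k) → Fin (N + 1)) :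
    Metric.ediam (approxCell k q p n N g) ≤
      ENNReal.ofReal (q⁻¹ ^ (n + 1)) + ((k : ℝ≥0∞) ^ n / N) ^ (1 / p) +
        ENNReal.ofReal (q⁻¹ ^ (n + 1)) := by
  have hp0 : 0 < p := zero_lt_one.trans_le hp.out
  let z : Fin k := ⟨0, hk⟩
  let e : (Fin n → Fin k) → RegularUltrametric k q := fun u => extend u z
  let κ₀ : Measure (Fin n → Fin k) :=
    Measure.sum fun u => (((g u : ℕ) : ℝ≥0∞) / N) • Measure.dirac u
  have he : Measurable e := measurable_of_countable _
  have hi := measurable_initial (k := k) (q := q) n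
  have hT : Measurable (e ∘ initial n) := he.comp hi
  have hmove : ∀ x, edist x ((e ∘ initial n) x) ≤ ENNReal.ofReal (q⁻¹ ^ (n + 1)) := fun x =>
    edist_le_of_initial_eq (initial_extend _ _).symm
  have hle : ∀ μ ∈ approxCell k q p n N g,
      κ₀.map e ≤ (μ.toProbabilityMeasure : Measure (RegularUltrametric k q)).map
        (e ∘ initial n) := by
    intro μ hμ
    rw [← Measure.map_map he hi]
    refine Measure.map_mono ?_ he
    rw [← Measure.sum_smul_dirac (Measure.map (initial n)
      (μ.toProbabilityMeasure : Measure (RegularUltrametric k q)))]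
    refine Measure.le_intro fun s hs _ => ?_
    rw [Measure.sum_apply _ hs, Measure.sum_apply _ hs]
    refine ENNReal.tsum_le_tsum fun u => ?_
    rw [Measure.smul_apply, Measure.smul_apply, Measure.map_apply hi (measurableSet_singleton u)]
    exact mul_le_mul_left (hμ u).1 _
  refine Metric.ediam_le fun μ hμ ν hν => ?_
  change wassersteinEDist p (μ.toProbabilityMeasure : Measure (RegularUltrametric k q))
    ν.toProbabilityMeasure ≤ _
  have hμT := Measure.isProbabilityMeasure_map (μ := (μ.toProbabilityMeasure :
    Measure (RegularUltrametric k q))) hT.aemeasurable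
  have hνT := Measure.isProbabilityMeasure_map (μ := (ν.toProbabilityMeasure :
    Measure (RegularUltrametric k q))) hT.aemeasurable
  have hmass : 1 ≤ (κ₀.map e) Set.univ + (k : ℝ≥0∞) ^ n / N := by
    have h1 : (1 : ℝ≥0∞) = ∑ u, (μ.toProbabilityMeasure : Measure (RegularUltrametric k q))
        (initial n ⁻¹' {u}) := by
      have := Measure.isProbabilityMeasure_map (μ := (μ.toProbabilityMeasure :
        Measure (RegularUltrametric k q))) hi.aemeasurable
      rw [← measure_univ (μ := Measure.map (initial n)
        (μ.toProbabilityMeasure : Measure (RegularUltrametric k q))), ← Finset.coe_univ,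
        ← sum_measure_singleton]
      exact Finset.sum_congr rfl fun u _ => Measure.map_apply hi (measurableSet_singleton u)
    rw [Measure.map_apply he .univ, Set.preimage_univ, Measure.sum_apply _ .univ, tsum_fintype, h1]
    calc _ ≤ ∑ u : Fin n → Fin k, (((g u : ℕ) : ℝ≥0∞) / N + 1 / N) :=
          Finset.sum_le_sum fun u _ => (hμ u).2.trans_eq ENNReal.add_div
      _ = _ := by
          rw [Finset.sum_add_distrib]
          congr 1
          · simp
          · simp [div_eq_mul_inv]
  refine (wassersteinEDist_triangle hp.out _ ((ν.toProbabilityMeasure :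
    Measure (RegularUltrametric k q)).map (e ∘ initial n)) _).trans (add_le_add
      ((wassersteinEDist_triangle hp.out _ ((μ.toProbabilityMeasure :
        Measure (RegularUltrametric k q)).map (e ∘ initial n)) _).trans (add_le_add ?_ ?_)) ?_)
  · exact wassersteinEDist_map_le hp0 _ hT hmove
  · exact wassersteinEDist_le_of_common hp0 edist_le_one (hle μ hμ) (hle ν hν) hmass
  · exact (wassersteinEDist_comm_le hp0 _ _).trans (wassersteinEDist_map_le hp0 _ hT hmove)

/-- The exponent which bounds the sums of the gauge over the covers by approximation cells. -/
theorem tendsto_entropy_sub_gauge {a b L c : ℝ} (ha : 0 < a) (hb : 1 < b) (hab : a < b)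
    (hc : 0 < c) :
    Tendsto (fun n : ℕ => a ^ n * (L * (n + 1)) - c * b ^ n) atTop atBot := by
  have hb0 : 0 < b := by linarith
  have hx0 : 0 ≤ a / b := by positivity
  have hx1 : a / b < 1 := (div_lt_one hb0).2 hab
  -- The bracket that remains once `b ^ n` is factored out.
  have h1 : Tendsto (fun n : ℕ => L * (n * (a / b) ^ n + (a / b) ^ n) - c) atTop (𝓝 (-c)) := by
    have := (((tendsto_self_mul_const_pow_of_lt_one hx0 hx1).add
      (tendsto_pow_atTop_nhds_zero_of_lt_one hx0 hx1)).const_mul L).sub_const c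
    simpa using this
  refine (Tendsto.atTop_mul_neg (neg_lt_zero.2 hc)
    (tendsto_pow_atTop_atTop_of_one_lt hb) h1).congr fun n => ?_
  rw [div_pow]
  field_simp

/-- The logarithm of the number of cells is at most `L (n+1) k^n`, which loses to the gauge exponent
`3^{-s} q^{sn}` when `k < q^s`. -/
theorem mkMetric_wassersteinSpace_eq_zero (hk : 1 ≤ k) (p : ℝ) [hp : Fact (1 ≤ p)] {s : ℝ}
    (hs0 : 0 < s) (hs : (k : ℝ) < q ^ s) :
    OuterMeasure.mkMetric (powerExpGauge s)
      (Set.univ : Set (WassersteinSpace p (RegularUltrametric k q))) = 0 := by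
  have hp0 : 0 < p := zero_lt_one.trans_le hp.out
  have hq1 := hq.out
  have hq0 : 0 < q := zero_lt_one.trans hq1
  have hk0 : (0 : ℝ) < k := by exact_mod_cast hk
  obtain ⟨M, hM⟩ := exists_nat_ge (q ^ p)
  have hM0 : (0 : ℝ) < M := (Real.rpow_pos_of_pos hq0 p).trans_le hM
  have hM1 : 0 < M := by exact_mod_cast hM0
  have hM' : (M : ℝ)⁻¹ ^ (1 / p) ≤ q⁻¹ := by
    rw [Real.inv_rpow hM0.le]
    refine inv_anti₀ hq0 ?_
    calc q = (q ^ p) ^ (1 / p) := by rw [one_div, Real.rpow_rpow_inv hq0.le hp0.ne']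
      _ ≤ _ := Real.rpow_le_rpow (by positivity) hM (by positivity)
  -- This makes `k^n / N = M^{-n}`, whose `1/p`-th power is at most `q^{-n}` because `M ≥ q^p`.
  let N : ℕ → ℕ := fun n => (k * M) ^ n
  have hN : ∀ n, 0 < N n := fun n => pow_pos (Nat.mul_pos hk hM1) n
  have hdiam : ∀ n g, Metric.ediam (approxCell k q p n (N n) g) ≤
      ENNReal.ofReal (3 * q⁻¹ ^ n) := by
    intro n g
    refine (ediam_approxCell_le hk n (N n) g).trans ?_
    have e1 : ((k : ℝ≥0∞) ^ n / (N n : ℕ)) ^ (1 / p) =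
        ENNReal.ofReal (((M : ℝ)⁻¹ ^ (1 / p)) ^ n) := by
      have : (k : ℝ≥0∞) ^ n / (N n : ℕ) = ENNReal.ofReal ((M : ℝ)⁻¹ ^ n) := by
        have h2 : (M : ℝ)⁻¹ ^ n = (k : ℝ) ^ n / (N n : ℕ) := by
          simp only [N]; push_cast; rw [mul_pow, inv_pow]; field_simp
        rw [h2, ENNReal.ofReal_div_of_pos (by exact_mod_cast hN n),
          ENNReal.ofReal_pow hk0.le, ENNReal.ofReal_natCast, ENNReal.ofReal_natCast]
      rw [this, ENNReal.ofReal_rpow_of_pos (by positivity), ← Real.rpow_natCast,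
        ← Real.rpow_mul (by positivity), mul_comm, Real.rpow_mul (by positivity),
        Real.rpow_natCast]
    rw [e1, ← ENNReal.ofReal_add (by positivity) (by positivity),
      ← ENNReal.ofReal_add (by positivity) (by positivity)]
    refine ENNReal.ofReal_le_ofReal ?_
    have h3 : ((M : ℝ)⁻¹ ^ (1 / p)) ^ n ≤ q⁻¹ ^ n := pow_le_pow_left₀ (by positivity) hM' n
    have h4 : q⁻¹ ^ (n + 1) ≤ q⁻¹ ^ n :=
      pow_le_pow_of_le_one (by positivity) (inv_le_one_of_one_le₀ hq1.le) (Nat.le_succ n)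
    linarith
  have hr : Tendsto (fun n : ℕ => ENNReal.ofReal (3 * q⁻¹ ^ n)) atTop (𝓝 0) := by
    rw [← ENNReal.ofReal_zero, ← mul_zero (3 : ℝ)]
    exact ENNReal.tendsto_ofReal ((tendsto_pow_atTop_nhds_zero_of_lt_one (by positivity)
      (inv_lt_one_of_one_lt₀ hq1)).const_mul 3)
  borelize (WassersteinSpace p (RegularUltrametric k q))
  have hcover := Measure.mkMetric_le_liminf_sum (Set.univ) _ hr
    (fun n g => approxCell k q p n (N n) g) (Eventually.of_forall hdiam)
    (Eventually.of_forall fun n => (iUnion_approxCell p n (hN n)).ge) (powerExpGauge s)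
  rw [← Measure.coe_toOuterMeasure, Measure.mkMetric_toOuterMeasure] at hcover
  refine le_antisymm (hcover.trans ?_) zero_le
  set L := Real.log (k * M + 1) with hL
  have hbound : ∀ n, ∑ g, powerExpGauge s (Metric.ediam (approxCell k q p n (N n) g)) ≤
      ENNReal.ofReal (Real.exp ((k : ℝ) ^ n * (L * (n + 1)) - (3 ^ s)⁻¹ * (q ^ s) ^ n)) := by
    intro n
    have hcard : ((N n : ℝ) + 1) ≤ Real.exp (L * (n + 1)) := by
      have h1 : (1 : ℝ) ≤ k * M := by exact_mod_cast Nat.mul_pos hk hM1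
      have h2 : Real.exp (L * (n + 1)) = (k * M + 1 : ℝ) ^ (n + 1) := by
        rw [hL, ← Real.rpow_def_of_pos (by positivity), ← Nat.cast_succ, Real.rpow_natCast]
      rw [h2]
      simp only [N]
      push_cast
      have h3 : ((k : ℝ) * M) ^ n ≤ (k * M + 1) ^ n :=
        pow_le_pow_left₀ (by positivity) (by linarith) n
      have h4 : (1 : ℝ) ≤ (k * M + 1) ^ n := one_le_pow₀ (by linarith)
      rw [pow_succ]
      nlinarith
    calc _ ≤ ∑ _g : (Fin n → Fin k) → Fin (N n + 1),
          powerExpGauge s (ENNReal.ofReal (3 * q⁻¹ ^ n)) :=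
          Finset.sum_le_sum fun g _ => powerExpGauge_mono hs0.le (hdiam n g)
      _ = ENNReal.ofReal (((N n : ℝ) + 1) ^ (k ^ n) * Real.exp (-((3 * q⁻¹ ^ n) ^ s)⁻¹)) := by
          rw [powerExpGauge_ofReal s (by positivity), ENNReal.ofReal_mul (by positivity),
            Finset.sum_const, nsmul_eq_mul]
          congr 1
          rw [ENNReal.ofReal_pow (by positivity)]
          simp [ENNReal.ofReal_add]
      _ ≤ _ := by
          refine ENNReal.ofReal_le_ofReal ?_
          rw [sub_eq_add_neg, Real.exp_add]
          refine mul_le_mul ?_ (le_of_eq ?_) (by positivity) (by positivity)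
          · calc ((N n : ℝ) + 1) ^ (k ^ n) ≤ Real.exp (L * (n + 1)) ^ (k ^ n) :=
                  pow_le_pow_left₀ (by positivity) hcard _
              _ = _ := by rw [← Real.exp_nat_mul]; push_cast; rfl
          · congr 2
            rw [Real.mul_rpow (by positivity) (by positivity), mul_inv, inv_pow,
              Real.inv_rpow (by positivity), inv_inv, ← Real.rpow_natCast, ← Real.rpow_mul hq0.le,
              mul_comm (n : ℝ), Real.rpow_mul hq0.le, Real.rpow_natCast]
  refine (liminf_le_liminf (Eventually.of_forall hbound)).trans_eq (Tendsto.liminf_eq ?_)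
  rw [← ENNReal.ofReal_zero]
  refine ENNReal.tendsto_ofReal (Real.tendsto_exp_atBot.comp ?_)
  exact tendsto_entropy_sub_gauge hk0 (Real.one_lt_rpow hq1 hs0) hs (by positivity)

theorem powerExpCrit_le (hk : 1 ≤ k) (p : ℝ) [hp : Fact (1 ≤ p)] :
    powerExpCrit (WassersteinSpace p (RegularUltrametric k q)) ≤
      ENNReal.ofReal (Real.logb q k) := by
  have hq1 := hq.out
  have hk0 : (0 : ℝ) < k := by exact_mod_cast hk
  refine iSup_le fun s => iSup₂_le fun hs htop => ?_
  by_contra! hlt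
  have hlt' : Real.logb q k < s := by
    rw [← ENNReal.ofReal_coe_nnreal] at hlt
    exact (ENNReal.ofReal_lt_ofReal_iff (by exact_mod_cast hs)).1 hlt
  have hks : (k : ℝ) < q ^ (s : ℝ) := (Real.logb_lt_iff_lt_rpow hq1 hk0).1 hlt'
  rw [mkMetric_wassersteinSpace_eq_zero hk p (by exact_mod_cast hs) hks] at htop
  exact ENNReal.zero_ne_top htop

end RegularUltrametric

/-! ### Lower bounds for the Wasserstein distance -/

/-- If `μ` gives to a set more mass than `ν` does, the excess has to be moved out of the set. -/
theorem le_wassersteinEDist {X : Type*} [MetricSpace X] [CompactSpace X] [MeasurableSpace X]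
    [BorelSpace X] {p : ℝ} (hp : 0 < p) {μ ν : Measure X} [IsFiniteMeasure ν] {F : Set X}
    (hF : MeasurableSet F) {r ε : ℝ≥0∞} (hr : ∀ x ∈ F, ∀ y ∉ F, r ≤ edist x y)
    (hε : ν F + ε ≤ μ F) : ε ^ (1 / p) * r ≤ wassersteinEDist p μ ν := by
  rw [wassersteinEDist_eq_iInf hp]
  refine le_iInf₂ fun π hπ => ?_
  -- Any plan carries mass at least `ε` from `F` to its complement, over a distance at least `r`;
  -- Markov's inequality turns this into a cost.
  have hmarkov := mul_meas_ge_le_lintegral (μ := π) (measurable_edist_rpow (X := X) p) (r ^ p)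
  have hmove : ε ≤ π {z | r ^ p ≤ edist z.1 z.2 ^ p} := by
    refine (ENNReal.add_le_add_iff_left (measure_ne_top ν F)).1 (hε.trans ?_)
    rw [← hπ.1, ← hπ.2, Measure.map_apply measurable_fst hF, Measure.map_apply measurable_snd hF]
    refine (measure_mono fun z hz => ?_).trans (measure_union_le _ _)
    by_cases h2 : z.2 ∈ F
    · exact Or.inl h2
    · exact Or.inr (ENNReal.rpow_le_rpow (hr z.1 hz z.2 h2) hp.le)
  calc ε ^ (1 / p) * r = (r ^ p * ε) ^ (1 / p) := by
        rw [ENNReal.mul_rpow_of_nonneg _ _ (by positivity), one_div,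
          ENNReal.rpow_rpow_inv hp.ne', mul_comm]
    _ ≤ transportCost p π ^ (1 / p) :=
        ENNReal.rpow_le_rpow ((mul_le_mul_right hmove _).trans hmarkov) (by positivity)

namespace RegularUltrametric

variable {k : ℕ} {q : ℝ}

/-- The words which begin with a word `u ∈ A` of length `m` followed by the letter `b`. -/
def cylinderUnion (q : ℝ) {m : ℕ} (b : Fin k) (A : Finset (Fin m → Fin k)) :
    Set (RegularUltrametric k q) :=
  {x | x.initial m ∈ A ∧ x.word m = b}

theorem mem_cylinderUnion_of_initial {m n : ℕ} (hmn : m < n) {b : Fin k}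
    {A : Finset (Fin m → Fin k)} {x y : RegularUltrametric k q}
    (h : x.initial n = y.initial n) (hx : x ∈ cylinderUnion q b A) : y ∈ cylinderUnion q b A :=
  ⟨initial_eq_of_le hmn.le h ▸ hx.1, initial_eq_iff.1 h m hmn ▸ hx.2⟩

theorem extend_mem_cylinderUnion {m : ℕ} {b z : Fin k} {A : Finset (Fin m → Fin k)}
    {u : Fin m → Fin k} :
    (extend u z : RegularUltrametric k q) ∈ cylinderUnion q b A ↔ u ∈ A ∧ z = b := by
  rw [cylinderUnion, Set.mem_ofPred_eq, initial_extend]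
  simp [extend]

variable [hq : Fact (1 < q)]

/-! ### Measures with prescribed signs -/

/-- The uniform measure on the words `u c c c …`, where `u` is a word of length `n` and the letter
`c` is one of `a` and `b`, according to the sign of `u`. -/
def levelMeasure (q : ℝ) [Fact (1 < q)] (a b : Fin k) (n : ℕ) (σ : (Fin n → Fin k) → Bool) :
    Measure (RegularUltrametric k q) :=
  ((k : ℝ≥0∞) ^ n)⁻¹ • ∑ u, Measure.dirac (extend u (bif σ u then b else a))

/-- The combination of the measures `levelMeasure` with geometric weights. -/
def signMeasure (q : ℝ) [Fact (1 < q)] (a b : Fin k) (θ : ℝ)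
    (σ : ∀ n, (Fin n → Fin k) → Bool) : Measure (RegularUltrametric k q) :=
  Measure.sum fun n => ENNReal.ofReal ((1 - θ) * θ ^ n) • levelMeasure q a b n (σ n)

theorem levelMeasure_apply (a b : Fin k) (n : ℕ) (σ : (Fin n → Fin k) → Bool)
    {F : Set (RegularUltrametric k q)} (hF : MeasurableSet F) :
    levelMeasure q a b n σ F =
      ((k : ℝ≥0∞) ^ n)⁻¹ * ∑ u, F.indicator 1 (extend u (bif σ u then b else a)) := by
  simp [levelMeasure, hF]

theorem levelMeasure_univ (a b : Fin k) (n : ℕ) (σ : (Fin n → Fin k) → Bool) :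
    levelMeasure q a b n σ Set.univ = 1 := by
  have hk : (k : ℝ≥0∞) ^ n ≠ 0 := pow_ne_zero _ (by exact_mod_cast (Fin.pos a).ne')
  rw [levelMeasure_apply a b n σ .univ]
  simp [ENNReal.inv_mul_cancel hk]

theorem isProbabilityMeasure_signMeasure (a b : Fin k) {θ : ℝ} (h0 : 0 ≤ θ) (h1 : θ < 1)
    (σ : ∀ n, (Fin n → Fin k) → Bool) : IsProbabilityMeasure (signMeasure q a b θ σ) := by
  refine ⟨?_⟩
  have hsum : HasSum (fun n : ℕ => (1 - θ) * θ ^ n) 1 := by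
    have := (hasSum_geometric_of_lt_one h0 h1).mul_left (1 - θ)
    rwa [mul_inv_cancel₀ (by linarith)] at this
  have hnn : ∀ n : ℕ, 0 ≤ (1 - θ) * θ ^ n := fun n => mul_nonneg (by linarith) (by positivity)
  rw [signMeasure, Measure.sum_apply _ .univ]
  simp only [Measure.smul_apply, levelMeasure_univ, smul_eq_mul, mul_one]
  rw [← ENNReal.ofReal_tsum_of_nonneg hnn hsum.summable, hsum.tsum_eq, ENNReal.ofReal_one]

theorem measurableSet_cylinderUnion {m : ℕ} (b : Fin k) (A : Finset (Fin m → Fin k)) :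
    MeasurableSet (cylinderUnion q b A) :=
  measurableSet_of_initial fun _ _ h hx => mem_cylinderUnion_of_initial (Nat.lt_succ_self m) h hx

/-- The signs of level `n` do not influence the masses of the cylinders of length at most `n`. -/
theorem levelMeasure_cylinderUnion_of_lt (a b : Fin k) {m n : ℕ} (hmn : m < n)
    (σ τ : (Fin n → Fin k) → Bool) (A : Finset (Fin m → Fin k)) :
    levelMeasure q a b n σ (cylinderUnion q b A) =
      levelMeasure q a b n τ (cylinderUnion q b A) := by
  rw [levelMeasure_apply _ _ _ _ (measurableSet_cylinderUnion b A),
    levelMeasure_apply _ _ _ _ (measurableSet_cylinderUnion b A)]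
  congr 1
  refine Finset.sum_congr rfl fun u _ => ?_
  have h : (extend u (bif σ u then b else a) : RegularUltrametric k q).initial n =
      (extend u (bif τ u then b else a) : RegularUltrametric k q).initial n := by
    rw [initial_extend, initial_extend]
  classical
  simp only [Set.indicator_apply]
  exact if_congr ⟨mem_cylinderUnion_of_initial hmn h, mem_cylinderUnion_of_initial hmn h.symm⟩
    rfl rfl

/-- The comparison is made level by level. Levels below `m` have the same signs. At level `m` one
measure puts at least `1/16` of its mass in the set and the other none. Levels above `m` agree on
the set, which depends only on the first `m + 1` letters. -/
theorem signMeasure_add_le {a b : Fin k} (hab : a ≠ b) {θ : ℝ} (h0 : 0 ≤ θ) (h1 : θ < 1)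
    {σ τ : ∀ n, (Fin n → Fin k) → Bool} {m : ℕ} (hlt : ∀ n < m, σ n = τ n)
    {A : Finset (Fin m → Fin k)} (hσ : ∀ u ∈ A, σ m u = true) (hτ : ∀ u ∈ A, τ m u = false)
    (hA : k ^ m ≤ 16 * A.card) :
    signMeasure q a b θ τ (cylinderUnion q b A) + ENNReal.ofReal ((1 - θ) * θ ^ m / 16) ≤
      signMeasure q a b θ σ (cylinderUnion q b A) := by
  have hk : (k : ℝ≥0∞) ^ m ≠ 0 := pow_ne_zero _ (by exact_mod_cast (Fin.pos a).ne')
  have hkt : (k : ℝ≥0∞) ^ m ≠ ∞ := ENNReal.pow_ne_top (ENNReal.natCast_ne_top k)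
  have hF := measurableSet_cylinderUnion (q := q) b A
  rw [signMeasure, signMeasure, Measure.sum_apply _ hF, Measure.sum_apply _ hF,
    ← tsum_ite_eq m (fun _ => ENNReal.ofReal ((1 - θ) * θ ^ m / 16)), ← ENNReal.tsum_add]
  refine ENNReal.tsum_le_tsum fun n => ?_
  rw [Measure.smul_apply, Measure.smul_apply]
  rcases lt_trichotomy n m with hn | rfl | hn
  · rw [hlt n hn, if_neg hn.ne, add_zero]
  · have e1 : levelMeasure q a b n (τ n) (cylinderUnion q b A) = 0 := by
      rw [levelMeasure_apply _ _ _ _ hF]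
      refine mul_eq_zero_of_right _ (Finset.sum_eq_zero fun u _ => ?_)
      refine Set.indicator_of_notMem (fun hu => ?_) _
      obtain ⟨huA, hz⟩ := extend_mem_cylinderUnion.1 hu
      rw [hτ u huA] at hz
      exact hab hz
    have e2 : (16 : ℝ≥0∞)⁻¹ ≤ levelMeasure q a b n (σ n) (cylinderUnion q b A) := by
      rw [levelMeasure_apply _ _ _ _ hF, ← ENNReal.div_eq_inv_mul,
        ENNReal.le_div_iff_mul_le (Or.inl hk) (Or.inl hkt), ← ENNReal.div_eq_inv_mul]
      refine ENNReal.div_le_of_le_mul' ?_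
      calc (k : ℝ≥0∞) ^ n ≤ 16 * A.card := by exact_mod_cast hA
        _ = 16 * ∑ u ∈ A, 1 := by simp
        _ = 16 * ∑ u ∈ A, (cylinderUnion q b A).indicator 1
              (extend u (bif σ n u then b else a)) := by
            congr 1
            refine Finset.sum_congr rfl fun u hu => ?_
            rw [Set.indicator_of_mem, Pi.one_apply]
            exact extend_mem_cylinderUnion.2 ⟨hu, by rw [hσ u hu]; rfl⟩
        _ ≤ _ := by
            gcongr
            exact Finset.subset_univ A
    rw [e1, if_pos rfl, smul_zero, zero_add, smul_eq_mul, div_eq_mul_inv,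
      ENNReal.ofReal_mul (mul_nonneg (by linarith) (by positivity)),
      ENNReal.ofReal_inv_of_pos (by norm_num), ENNReal.ofReal_ofNat]
    gcongr
  · rw [levelMeasure_cylinderUnion_of_lt a b hn (σ n) (τ n) A, if_neg hn.ne', add_zero]

theorem le_wassersteinEDist_signMeasure_of_finset {p : ℝ} (hp : 0 < p) {a b : Fin k} (hab : a ≠ b)
    {θ : ℝ} (h0 : 0 ≤ θ) (h1 : θ < 1) {σ τ : ∀ n, (Fin n → Fin k) → Bool} {m : ℕ}
    (hlt : ∀ n < m, σ n = τ n) {A : Finset (Fin m → Fin k)} (hσ : ∀ u ∈ A, σ m u = true)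
    (hτ : ∀ u ∈ A, τ m u = false) (hA : k ^ m ≤ 16 * A.card) :
    ENNReal.ofReal ((1 - θ) * θ ^ m / 16) ^ (1 / p) * ENNReal.ofReal (q⁻¹ ^ (m + 1)) ≤
      wassersteinEDist p (signMeasure q a b θ σ) (signMeasure q a b θ τ) := by
  have := isProbabilityMeasure_signMeasure (q := q) a b h0 h1 τ
  refine le_wassersteinEDist hp (measurableSet_cylinderUnion b A) (fun x hx y hy => ?_)
    (signMeasure_add_le hab h0 h1 hlt hσ hτ hA)
  exact le_edist_of_initial_ne fun h =>
    hy (mem_cylinderUnion_of_initial (Nat.lt_succ_self m) h hx)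

/-- The measures of two families of signs which differ first at the level `m`, and there in a
positive proportion of the words, are far apart. -/
theorem le_wassersteinEDist_signMeasure {p : ℝ} (hp : 0 < p) {a b : Fin k} (hab : a ≠ b)
    {θ : ℝ} (h0 : 0 ≤ θ) (h1 : θ < 1) {σ τ : ∀ n, (Fin n → Fin k) → Bool} {m : ℕ}
    (hlt : ∀ n < m, σ n = τ n) (hm : k ^ m ≤ 8 * hammingDist (σ m) (τ m)) :
    ENNReal.ofReal ((1 - θ) * θ ^ m / 16) ^ (1 / p) * ENNReal.ofReal (q⁻¹ ^ (m + 1)) ≤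
      wassersteinEDist p (signMeasure q a b θ σ) (signMeasure q a b θ τ) := by
  set A := Finset.univ.filter fun u => σ m u = true ∧ τ m u = false with hA
  set B := Finset.univ.filter fun u => τ m u = true ∧ σ m u = false with hB
  have hcard : hammingDist (σ m) (τ m) ≤ A.card + B.card := by
    refine (Finset.card_le_card fun u hu => ?_).trans (Finset.card_union_le A B)
    have hne : σ m u ≠ τ m u := (Finset.mem_filter.1 hu).2
    rw [Finset.mem_union, hA, hB, Finset.mem_filter, Finset.mem_filter]
    revert hne
    cases σ m u <;> cases τ m u <;> simp
  -- The larger of the two sets of one-sided disagreements contains at least half of them, which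
  -- turns `8` into `16`.
  rcases le_total (A.card) (B.card) with hle | hle
  · refine (le_wassersteinEDist_signMeasure_of_finset hp hab h0 h1 (σ := τ) (τ := σ)
      (fun n hn => (hlt n hn).symm) (A := B) (fun u hu => (Finset.mem_filter.1 hu).2.1)
      (fun u hu => (Finset.mem_filter.1 hu).2.2) (by omega)).trans
        (wassersteinEDist_comm_le hp _ _)
  · exact le_wassersteinEDist_signMeasure_of_finset hp hab h0 h1 hlt (A := A)
      (fun u hu => (Finset.mem_filter.1 hu).2.1) (fun u hu => (Finset.mem_filter.1 hu).2.2)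
      (by omega)

theorem mkMetric_wassersteinSpace_eq_top (p : ℝ) [hp : Fact (1 ≤ p)] {s : ℝ}
    (hs0 : 0 < s) (hs : q ^ s < (k : ℝ)) :
    OuterMeasure.mkMetric (powerExpGauge s)
      (Set.univ : Set (WassersteinSpace p (RegularUltrametric k q))) = ∞ := by
  have hp0 : 0 < p := zero_lt_one.trans_le hp.out
  have hq1 := hq.out
  have hq0 : 0 < q := zero_lt_one.trans hq1
  have hk1 : (1 : ℝ) < k := (Real.one_lt_rpow hq1 hs0).trans hs
  have hk2 : 1 < k := by exact_mod_cast hk1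
  have hqk : q < (k : ℝ) ^ s⁻¹ := (Real.lt_rpow_inv_iff_of_pos hq0.le (by positivity) hs0).2 hs
  -- The room between `q` and `k^{1/s}` is used twice: `q < t` makes the weights `θ ^ n` summable,
  -- and `t^s < k` lets the codes beat the gauge.
  obtain ⟨t, hqt, htk⟩ := exists_between hqk
  have ht0 : 0 < t := hq0.trans hqt
  have hts : t ^ s < k := (Real.lt_rpow_inv_iff_of_pos ht0.le (by positivity) hs0).1 htk
  have ht1 : 1 < t := hq1.trans hqt
  have hqt0 : 0 < q / t := by positivity
  have hqt1 : q / t < 1 := (div_lt_one ht0).2 hqt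
  -- Chosen so that `(θ^m)^{1/p} q^{-m} = t^{-m}`.
  set θ := (q / t) ^ p with hθ
  have hθ0 : 0 ≤ θ := by positivity
  have hθ1 : θ < 1 := Real.rpow_lt_one hqt0.le hqt1 hp0
  set c := ((1 - θ) / 16) ^ (1 / p) * q⁻¹ with hc
  have hc0 : 0 < c := mul_pos (Real.rpow_pos_of_pos (by linarith) _) (by positivity)
  let a : Fin k := ⟨0, by omega⟩
  let b : Fin k := ⟨1, hk2⟩
  have hab : a ≠ b := by simp [a, b]
  have : Nonempty (Fin k) := ⟨a⟩
  choose code hsep hcard using fun n : ℕ => exists_code (Fin n → Fin k)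
  have hne : ∀ n, Nonempty (code n) := by
    intro n
    have h1 : (0 : ℝ) < (code n).card := lt_of_lt_of_le (by positivity) (hcard n)
    exact (Finset.card_pos.1 (by exact_mod_cast h1)).to_subtype
  let Φ : (∀ n, code n) → WassersteinSpace p (RegularUltrametric k q) := fun ω =>
    ⟨⟨signMeasure q a b θ fun n => ω n, isProbabilityMeasure_signMeasure a b hθ0 hθ1 _⟩⟩
  let r : ℕ → ℝ := fun n => c * t⁻¹ ^ n
  have hr0 : ∀ n, 0 < r n := fun n => by positivity
  have hranti : StrictAnti r := by
    refine strictAnti_nat_of_succ_lt fun n => ?_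
    exact mul_lt_mul_of_pos_left (pow_lt_pow_right_of_lt_one₀ (by positivity)
      (inv_lt_one_of_one_lt₀ ht1) (Nat.lt_succ_self n)) hc0
  have hr : Tendsto r atTop (𝓝 0) := by
    have := (tendsto_pow_atTop_nhds_zero_of_lt_one (r := t⁻¹) (by positivity)
      (inv_lt_one_of_one_lt₀ ht1)).const_mul c
    rwa [mul_zero] at this
  have hrm : ∀ m, ENNReal.ofReal (r m) =
      ENNReal.ofReal ((1 - θ) * θ ^ m / 16) ^ (1 / p) * ENNReal.ofReal (q⁻¹ ^ (m + 1)) := by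
    intro m
    have hnn : 0 ≤ (1 - θ) / 16 := by linarith
    have hθm : (θ ^ m) ^ (1 / p) = (q / t) ^ m := by
      rw [hθ, ← Real.rpow_natCast, ← Real.rpow_mul hqt0.le, ← Real.rpow_mul hqt0.le,
        ← Real.rpow_natCast]
      congr 1
      field_simp
    rw [mul_div_right_comm, ENNReal.ofReal_rpow_of_nonneg (by positivity) (by positivity),
      ← ENNReal.ofReal_mul (by positivity), Real.mul_rpow hnn (by positivity), hθm]
    congr 1
    simp only [r, hc]
    rw [pow_succ, div_pow, inv_pow, inv_pow]
    field_simp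
  refine ENNReal.eq_top_of_forall_nnreal_le fun C => ?_
  refine le_mkMetric_univ_of_separated (S := fun n => code n) Φ (fun n => ENNReal.ofReal (r n))
    ?_ (fun n => ENNReal.ofReal_pos.2 (hr0 n)) ?_ (powerExpGauge_mono hs0.le)
    (tendsto_powerExpGauge hs0 hr0 hr) ?_
  · intro x y n m hmn hxy
    classical
    have hex : ∃ j, x j ≠ y j := ⟨m, hxy⟩
    have hj : Nat.find hex ≤ n := (Nat.find_min' hex hxy).trans hmn
    have hjne := Nat.find_spec hex
    have hjlt : ∀ i < Nat.find hex, x i = y i := fun i hi => not_not.1 (Nat.find_min hex hi)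
    -- The distance is bounded below at the first level of disagreement, which is at most `n`, and
    -- `r` is decreasing.
    refine (ENNReal.ofReal_le_ofReal (hranti.antitone hj)).trans ?_
    rw [hrm]
    refine le_wassersteinEDist_signMeasure hp0 hab hθ0 hθ1
      (fun i hi => congrArg Subtype.val (hjlt i hi)) ?_
    have := hsep _ _ (x (Nat.find hex)).2 _ (y (Nat.find hex)).2
      fun h => hjne (Subtype.ext h)
    simpa using this
  · exact fun m n hmn => (ENNReal.ofReal_lt_ofReal_iff (hr0 m)).2 (hranti hmn)
  -- `L` absorbs both `c` and the shift from `n` to `n + 1` in the gauge.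
  · set L := ((c * t⁻¹) ^ s)⁻¹ with hL
    have hL0 : 0 < L := by positivity
    have hlog : 0 < Real.log (4 / 3) := Real.log_pos (by norm_num)
    have hlim := tendsto_entropy_sub_gauge (L := L) (Real.rpow_pos_of_pos ht0 s) hk1 hts hlog
    filter_upwards [hlim.eventually_le_atBot (-(C : ℝ))] with n hn
    rw [powerExpGauge_ofReal s (hr0 _), Finset.prod_range_succ]
    have hlast : (Fintype.card (code n) : ℝ≥0∞)⁻¹ ≤
        ENNReal.ofReal (Real.exp (-(Real.log (4 / 3) * k ^ n))) := by
      rw [Real.exp_neg, ENNReal.ofReal_inv_of_pos (Real.exp_pos _), ENNReal.inv_le_inv,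
        ← ENNReal.ofReal_natCast]
      refine ENNReal.ofReal_le_ofReal ?_
      have h1 := hcard n
      have h2 : Real.exp (Real.log (4 / 3) * k ^ n) = (4 / 3) ^ (k ^ n) := by
        rw [← Real.rpow_def_of_pos (by norm_num)]
        exact_mod_cast Real.rpow_natCast (4 / 3) (k ^ n)
      rw [h2, Fintype.card_coe]
      simpa using h1
    -- The code of level `n` alone is large enough; the earlier factors are only bounded by one.
    have hrest : ∏ m ∈ Finset.range n, (Fintype.card (code m) : ℝ≥0∞)⁻¹ ≤ 1 := by
      refine Finset.prod_le_one' fun m _ => ENNReal.inv_le_one.2 ?_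
      exact_mod_cast Nat.succ_le_of_lt (Fintype.card_pos (α := code m))
    have hC : (C : ℝ≥0∞) ≤ ENNReal.ofReal (Real.exp C) := by
      rw [← ENNReal.ofReal_coe_nnreal]
      exact ENNReal.ofReal_le_ofReal (by linarith [Real.add_one_le_exp (C : ℝ)])
    calc _ ≤ ENNReal.ofReal (Real.exp C) *
          (1 * ENNReal.ofReal (Real.exp (-(Real.log (4 / 3) * k ^ n)))) := by gcongr
      _ = ENNReal.ofReal (Real.exp (C + -(Real.log (4 / 3) * k ^ n))) := by
          rw [one_mul, ← ENNReal.ofReal_mul (by positivity), Real.exp_add]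
      _ ≤ _ := by
          refine ENNReal.ofReal_le_ofReal (Real.exp_le_exp.2 ?_)
          have hgauge : (r (n + 1) ^ s)⁻¹ = (t ^ s) ^ n * L := by
            have e : r (n + 1) = (c * t⁻¹) * t⁻¹ ^ n := by simp only [r]; ring
            have e' : (t⁻¹ ^ n) ^ s = ((t ^ s) ^ n)⁻¹ := by
              rw [inv_pow, Real.inv_rpow (by positivity), ← Real.rpow_natCast,
                ← Real.rpow_natCast, ← Real.rpow_mul ht0.le, ← Real.rpow_mul ht0.le, mul_comm]
            rw [e, Real.mul_rpow (by positivity) (by positivity), e', mul_inv, inv_inv, mul_comm]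
          -- The spare factor `n + 1` only brings the exponent to the form of
          -- `tendsto_entropy_sub_gauge`.
          have hmul : (t ^ s) ^ n * L ≤ (t ^ s) ^ n * (L * (n + 1)) := by
            refine mul_le_mul_of_nonneg_left ?_ (by positivity)
            nlinarith [(Nat.cast_nonneg n : (0 : ℝ) ≤ n)]
          rw [hgauge]
          linarith

theorem le_powerExpCrit (hk : 1 ≤ k) (p : ℝ) [hp : Fact (1 ≤ p)] :
    ENNReal.ofReal (Real.logb q k) ≤
      powerExpCrit (WassersteinSpace p (RegularUltrametric k q)) := by
  have hq1 := hq.out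
  have hk0 : (0 : ℝ) < k := by exact_mod_cast hk
  refine ENNReal.le_of_forall_nnreal_lt fun s hs => ?_
  rcases eq_or_ne s 0 with rfl | hs0
  · simp
  have hpos : 0 < s := pos_iff_ne_zero.2 hs0
  have hs' : (s : ℝ) < Real.logb q k := by
    rw [← ENNReal.ofReal_coe_nnreal] at hs
    exact (ENNReal.ofReal_lt_ofReal_iff_of_nonneg s.2).1 hs
  have hks : q ^ (s : ℝ) < k := (Real.lt_logb_iff_rpow_lt hq1 hk0).1 hs'
  exact le_iSup_of_le s (le_iSup₂_of_le hpos
    (mkMetric_wassersteinSpace_eq_top p (by exact_mod_cast hpos) hks) le_rfl)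

end RegularUltrametric

end

theorem mainTheorem5 (k : ℕ) (hk : 1 ≤ k) (q : ℝ) [Fact (1 < q)] (p : ℝ) [Fact (1 ≤ p)] :
    powerExpCrit (WassersteinSpace p (RegularUltrametric k q)) =
        ENNReal.ofReal (Real.logb q k) ∧
      ENNReal.ofReal (Real.logb q k) =
        dimH (Set.univ : Set (RegularUltrametric k q)) :=
  ⟨le_antisymm (RegularUltrametric.powerExpCrit_le hk p) (RegularUltrametric.le_powerExpCrit hk p),
    (RegularUltrametric.dimH_univ hk).symm⟩
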